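/- Let $\lambda$ be a Borel probability measure on $\mathbb{R}$ with $\lambda((0,\infty))=1$ and finite support, and suppose that $\lambda$ is non-lattice, that is, $\operatorname{supp}\lambda$ generates a dense additive subgroup of $\mathbb{R}$. Put $\sigma=\int x\,d\lambda(x)$, $|\operatorname{supp}\lambda|=\sup\{|x|:x\in\operatorname{supp}\lambda\}$ and $p(x)=\lambda((x,\infty))$, and for a $C^1$ function $g:\mathbb{R}\to\mathbb{C}$ put $$\|g\|_{C^1}=\sup\{|g(x)|+|g'(x)| : -1<x<|\operatorname{supp}\lambda|+1\}.$$ Then $p$ is piecewise constant and $p(x)=0$ for all $x\ge|\operatorname{supp}\lambda|$. Moreover, there is a function $t\mapsto o_t$, depending only on $\lambda$, with $o_t\to0$ as $t\to+\infty$, such that the following holds. Let $X_1,X_2,\dots$ be independent random variables with common distribution $\lambda$, on any probability space, let $S_n=X_1+\dots+X_n$, and for $t>|\operatorname{supp}\lambda|+1$ let $n_t=\inf\{n\in\mathbb{N}:S_n\ge t\}$. Then for every $t>|\operatorname{supp}\lambda|+1$ the time $n_t$ is almost surely finite, and for every $C^1$ function $g:\mathbb{R}\to\mathbb{C}$ the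 random variable $g(S_{n_t}-t)$ is integrable, the function $gp$ is integrable on $(0,\infty)$, and $$\left|\mathbb{E}\bigl(g(S_{n_t}-t)\bigr)-\frac1\sigma\int_0^\infty g(x)p(x)\,dx\right|\le o_t\,\|g\|_{C^1}.$$ -/

import Mathlib

namespace RenewalStopping

open MeasureTheory

noncomputable section

/-- The measure `lam` is non-lattice: its (topological) support generates a dense additive
subgroup of the real line. -/
def IsNonLattice (lam : Measure ℝ) : Prop :=
  Dense (AddSubgroup.closure lam.support : Set ℝ)

/-- `|supp lam|`, the supremum of the absolute values of the elements of the support. -/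
def suppBound (lam : Measure ℝ) : ℝ :=
  sSup ((fun x : ℝ => |x|) '' lam.support)

/-- The expectation `σ = ∫ x dlam(x)`. -/
def expectation (lam : Measure ℝ) : ℝ :=
  ∫ x, x ∂lam

/-- The tail function `p(x) = lam((x, ∞))`. -/
def tail (lam : Measure ℝ) (x : ℝ) : ℝ :=
  lam.real (Set.Ioi x)

/-- A function on the line is piecewise constant if there are finitely many points such that it
is constant on every interval that contains none of them. -/
def IsPiecewiseConstant (f : ℝ → ℝ) : Prop :=
  ∃ F : Set ℝ, F.Finite ∧ ∀ x y : ℝ, x ≤ y → Disjoint (Set.Icc x y) F → f x = f y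

/-- The local `C^1` norm of `g`, the supremum of `|g(x)| + |g'(x)|` over `-1 < x < L + 1`. It is
the supremum of a bounded nonempty set when `L ≥ 0` and `g` is of class `C^1` on the line. -/
def localC1Norm (L : ℝ) (g : ℝ → ℂ) : ℝ :=
  sSup ((fun x : ℝ => ‖g x‖ + ‖deriv g x‖) '' Set.Ioo (-1) (L + 1))

variable {Ω : Type*}

/-- The partial sums `S_n = X_1 + ... + X_n`; the sequence is indexed from zero here, so `X i`
stands for the step number `i + 1`. -/
def partialSum (X : ℕ → Ω → ℝ) (n : ℕ) (ω : Ω) : ℝ :=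
  ∑ i ∈ Finset.range n, X i ω

/-- The stopping time `n_t = inf {n : S_n ≥ t}` (equal to `0` by convention where no such `n`
exists). -/
def stoppingTime (X : ℕ → Ω → ℝ) (t : ℝ) (ω : Ω) : ℕ :=
  sInf {n : ℕ | t ≤ partialSum X n ω}

/-- The residue (overshoot) `S_{n_t} - t`. -/
def residue (X : ℕ → Ω → ℝ) (t : ℝ) (ω : Ω) : ℝ :=
  partialSum X (stoppingTime X t ω) ω - t

end

end RenewalStopping

namespace RenewalStopping
open MeasureTheory ProbabilityTheory Filter Topology Set

/-! Conditioning on the first step shows that f(t) = E g(S_{n_t} - t) solves `DelayEq` with f(t) =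
g(-t) for t ≤ 0 (`integral_residue_eq_sol`). Each value of f is an average of earlier ones, whence a
maximum principle. If f ≤ B, the gap B - f(y) persists, up to a positive factor, at y + b for every
b in the semigroup generated by the steps. Non-latticeness makes that semigroup eventually η-dense,
so for a Lipschitz solution the gap spreads over a window of length L and then to all later times.
The oscillation thus shrinks by a fixed factor until it is below any given δ, uniformly in the
solution (`oscillation`).

As f itself may jump, this is applied to D(t) = ∫_0^t f - m t, where m = `tailIntegral` / `mean` is
the slope for which D solves the delay equation. Hence integrals of f over [t, t + e] approach e m
(`average_tendsto`). To return from averages to values: the levels t and t + s are crossed at the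
same time unless the residue at t is below s, and the probability of so small a residue is again
controlled by an average (`sol_sub_shift_le`, `indicator_sol_le`).

Every estimate is uniform over data bounded by 1 and 1-Lipschitz, so a supremum over such data is
the rate. A general g is reduced to them by clamping to [0, L], rescaling and taking real and
imaginary parts. -/

/-- A finite family of weights `w` on step lengths between `a > 0` and `L`. -/
structure IsStepLaw (F : Finset ℝ) (w : ℝ → ℝ) (a L : ℝ) : Prop where
  pos : ∀ x ∈ F, 0 < w x
  sum_eq : ∑ x ∈ F, w x = 1
  min_pos : 0 < a
  min_le : ∀ x ∈ F, a ≤ x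
  le_max : ∀ x ∈ F, x ≤ L

/-- The delay equation `f(t) = ∑ w(x) f(t - x)` for `t > 0`. -/
def DelayEq (F : Finset ℝ) (w f : ℝ → ℝ) : Prop :=
  ∀ t, 0 < t → f t = ∑ x ∈ F, w x * f (t - x)

/-! ### Maximum principle and propagation of gaps -/

section DelayEquation

variable {F : Finset ℝ} {w : ℝ → ℝ} {a L : ℝ}

namespace IsStepLaw

lemma nonempty (hw : IsStepLaw F w a L) : F.Nonempty := by
  by_contra h
  have := hw.sum_eq
  simp [Finset.not_nonempty_iff_eq_empty.mp h] at this

lemma L_pos (hw : IsStepLaw F w a L) : 0 < L := by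
  obtain ⟨x, hx⟩ := hw.nonempty
  linarith [hw.min_pos, hw.min_le x hx, hw.le_max x hx]

lemma x_pos (hw : IsStepLaw F w a L) {x : ℝ} (hx : x ∈ F) : 0 < x :=
  hw.min_pos.trans_le (hw.min_le x hx)

lemma sum_mul_le (hw : IsStepLaw F w a L) {f : ℝ → ℝ} {B : ℝ} (h : ∀ x ∈ F, f x ≤ B) :
    ∑ x ∈ F, w x * f x ≤ B := by
  calc ∑ x ∈ F, w x * f x ≤ ∑ x ∈ F, w x * B :=
        Finset.sum_le_sum fun x hx => mul_le_mul_of_nonneg_left (h x hx) (hw.pos x hx).le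
    _ = B := by rw [← Finset.sum_mul, hw.sum_eq, one_mul]

lemma exists_nat_mul_ge (hw : IsStepLaw F w a L) (t : ℝ) : ∃ n : ℕ, t ≤ n * a := by
  obtain ⟨n, hn⟩ := exists_nat_ge (t / a)
  exact ⟨n, by rwa [div_le_iff₀ hw.min_pos] at hn⟩

/-- Maximum principle for subsolutions of the delay equation. -/
lemma max_principle (hw : IsStepLaw F w a L) {k : ℝ → ℝ} {τ B : ℝ}
    (hk : ∀ t, τ < t → k t ≤ ∑ x ∈ F, w x * k (t - x))
    (hB : ∀ t, τ - L ≤ t → t ≤ τ → k t ≤ B) : ∀ t, τ - L ≤ t → k t ≤ B := by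
  -- Every step is at least a, so the bound advances by a at each induction step; every step is at
  -- most L, so no argument falls below τ - L.
  have key : ∀ n : ℕ, ∀ t, τ - L ≤ t → t ≤ τ + n * a → k t ≤ B := by
    intro n
    induction n with
    | zero => intro t h1 h2; exact hB t h1 (by simpa using h2)
    | succ n ih =>
      intro t h1 h2
      rcases le_or_gt t τ with h | h
      · exact hB t h1 h
      · refine (hk t h).trans (hw.sum_mul_le (f := fun x => k (t - x)) fun x hx => ih _ ?_ ?_)
        · linarith [hw.le_max x hx]
        · push_cast at h2
          linarith [hw.min_le x hx]
  intro t h1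
  obtain ⟨n, hn⟩ := hw.exists_nat_mul_ge (t - τ)
  exact key n t h1 (by linarith)

/-- A solution bounded by `B` loses a fixed proportion of its gap to `B` along each element of the
semigroup generated by the steps. -/
lemma path_bound (hw : IsStepLaw F w a L) {b : ℝ} (hb : b ∈ AddSubmonoid.closure (F : Set ℝ)) :
    0 ≤ b ∧ ∃ v, 0 < v ∧ ∀ (f : ℝ → ℝ) (B y : ℝ), DelayEq F w f → 0 < y →
      (∀ s, y - L ≤ s → f s ≤ B) → f (y + b) ≤ B - v * (B - f y) := by
  induction hb using AddSubmonoid.closure_induction with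
  | mem x hx =>
    have hx : x ∈ F := by simpa using hx
    have hx0 := hw.x_pos hx
    refine ⟨hx0.le, w x, hw.pos x hx, fun f B y hf hy hB => ?_⟩
    rw [hf (y + x) (by linarith), ← Finset.add_sum_erase F _ hx]
    -- Only the term at y sees the gap; all others are estimated by B.
    have h1 : ∑ z ∈ F.erase x, w z * f (y + x - z) ≤ ∑ z ∈ F.erase x, w z * B := by
      refine Finset.sum_le_sum fun z hz => ?_
      have hz := Finset.mem_of_mem_erase hz
      refine mul_le_mul_of_nonneg_left (hB _ ?_) (hw.pos z hz).le
      linarith [hw.le_max z hz]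
    have h2 : w x + ∑ z ∈ F.erase x, w z = 1 := by
      rw [Finset.add_sum_erase F _ hx, hw.sum_eq]
    rw [← Finset.sum_mul] at h1
    have h3 : y + x - x = y := by ring
    rw [h3]
    have h4 : ∑ z ∈ F.erase x, w z = 1 - w x := by linarith
    rw [h4] at h1
    linarith
  | zero =>
    refine ⟨le_rfl, 1, one_pos, fun f B y hf hy hB => ?_⟩
    simp
  | add b c hb hc ihb ihc =>
    obtain ⟨hb0, v, hv, h1⟩ := ihb
    obtain ⟨hc0, u, hu, h2⟩ := ihc
    refine ⟨by positivity, u * v, by positivity, fun f B y hf hy hB => ?_⟩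
    have e1 := h1 f B y hf hy hB
    have e2 := h2 f B (y + b) hf (by linarith) (fun s hs => hB s (by linarith))
    rw [← add_assoc]
    nlinarith

end IsStepLaw

/-! ### Density of the semigroup of steps -/

lemma exists_sub_of_mem_closure {S : Set ℝ} {x : ℝ} (hx : x ∈ AddSubgroup.closure S) :
    ∃ b ∈ AddSubmonoid.closure S, ∃ c ∈ AddSubmonoid.closure S, x = b - c := by
  induction hx using AddSubgroup.closure_induction with
  | mem x hx => exact ⟨x, AddSubmonoid.subset_closure hx, 0, zero_mem _, by simp⟩
  | zero => exact ⟨0, zero_mem _, 0, zero_mem _, by simp⟩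
  | add x y _ _ h1 h2 =>
    obtain ⟨b, hb, c, hc, rfl⟩ := h1
    obtain ⟨b', hb', c', hc', rfl⟩ := h2
    exact ⟨b + b', add_mem hb hb', c + c', add_mem hc hc', by ring⟩
  | neg x _ h =>
    obtain ⟨b, hb, c, hc, rfl⟩ := h
    exact ⟨c, hc, b, hb, by ring⟩

/-- A semigroup of nonnegative reals that generates a dense group is eventually `η`-dense. -/
lemma eventually_dense {S : Set ℝ} (hS : ∀ x ∈ S, 0 ≤ x)
    (hd : Dense (AddSubgroup.closure S : Set ℝ)) {η : ℝ} (hη : 0 < η) :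
    ∃ T : ℝ, ∀ s, T ≤ s → ∃ b ∈ AddSubmonoid.closure S, |s - b| < η := by
  have hnn : ∀ b ∈ AddSubmonoid.closure S, 0 ≤ b := by
    intro b hb
    induction hb using AddSubmonoid.closure_induction with
    | mem x hx => exact hS x hx
    | zero => exact le_rfl
    | add x y _ _ h1 h2 => exact add_nonneg h1 h2
  obtain ⟨d, hd0, hdG⟩ := hd.exists_mem_open isOpen_Ioo (nonempty_Ioo.mpr hη)
  obtain ⟨b, hb, c, hc, rfl⟩ := exists_sub_of_mem_closure hd0
  set d := b - c with hdd
  have hdpos : 0 < d := hdG.1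
  have hbpos : 0 < b := by linarith [hnn c hc]
  -- Exchanging one c for one b gains d < η. With N copies of c available, N d ≥ b, so the points N
  -- c + k b + j d with j ≤ N fill the gap between successive multiples of b.
  obtain ⟨N, hN⟩ := exists_nat_ge (b / d)
  rw [div_le_iff₀ hdpos] at hN
  refine ⟨N * c, fun s hs => ?_⟩
  obtain ⟨k, hk1, hk2⟩ : ∃ k : ℕ, (k : ℝ) * b ≤ s - N * c ∧ s - N * c < (k + 1) * b := by
    refine ⟨⌊(s - N * c) / b⌋₊, ?_, ?_⟩
    · rw [← le_div_iff₀ hbpos]; exact Nat.floor_le (div_nonneg (by linarith) hbpos.le)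
    · rw [← div_lt_iff₀ hbpos]; exact Nat.lt_floor_add_one _
  obtain ⟨j, hj1, hj2⟩ : ∃ j : ℕ, (j : ℝ) * d ≤ s - N * c - k * b ∧
      s - N * c - k * b < (j + 1) * d := by
    refine ⟨⌊(s - N * c - k * b) / d⌋₊, ?_, ?_⟩
    · rw [← le_div_iff₀ hdpos]; exact Nat.floor_le (div_nonneg (by linarith) hdpos.le)
    · rw [← div_lt_iff₀ hdpos]; exact Nat.lt_floor_add_one _
  have hjN : j ≤ N := by
    have : (j : ℝ) * d ≤ N * d := by linarith
    exact_mod_cast le_of_mul_le_mul_right this hdpos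
  refine ⟨(N - j) • c + k • b + j • b, add_mem (add_mem (nsmul_mem hc _) (nsmul_mem hb _))
    (nsmul_mem hb _), ?_⟩
  simp only [nsmul_eq_mul, Nat.cast_sub hjN]
  have : s - ((N - j : ℝ) * c + k * b + j * b) = s - N * c - k * b - j * d := by
    rw [hdd]; ring
  rw [this, abs_of_nonneg (by linarith)]
  linarith [hdG.2]

/-! ### Contraction of the oscillation -/

namespace IsStepLaw

/-- The factor from `path_bound` depends on b. Since one b serves a whole neighbourhood of s,
compactness of the window leaves finitely many factors, and their minimum works throughout. -/
lemma uniform_path_bound (hw : IsStepLaw F w a L)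
    (hd : Dense (AddSubgroup.closure (F : Set ℝ) : Set ℝ)) {η : ℝ} (hη : 0 < η) :
    ∃ T v : ℝ, 0 < T ∧ 0 < v ∧ v < 1 ∧ ∀ s ∈ Icc T (T + L), ∃ b : ℝ, |s - b| < η ∧
      ∀ (f : ℝ → ℝ) (B y : ℝ), DelayEq F w f → 0 < y →
      (∀ s, y - L ≤ s → f s ≤ B) → f (y + b) ≤ B - v * (B - f y) := by
  obtain ⟨T, hT⟩ := eventually_dense (S := (F : Set ℝ))
    (fun x hx => (hw.x_pos (by simpa using hx)).le) hd hη
  set T' := max T 1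
  have hcomp : IsCompact (Icc T' (T' + L)) := isCompact_Icc
  suffices h : ∃ v : ℝ, 0 < v ∧ v < 1 ∧ ∀ s ∈ Icc T' (T' + L), ∃ b : ℝ, |s - b| < η ∧
      ∀ (f : ℝ → ℝ) (B y : ℝ), DelayEq F w f → 0 < y →
      (∀ s, y - L ≤ s → f s ≤ B) → f (y + b) ≤ B - v * (B - f y) by
    obtain ⟨v, h⟩ := h
    exact ⟨T', v, lt_of_lt_of_le one_pos (le_max_right _ _), h⟩
  have hmono : ∀ {v u b : ℝ}, u ≤ v → 0 ≤ b → (∀ (f : ℝ → ℝ) (B y : ℝ), DelayEq F w f → 0 < y →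
      (∀ s, y - L ≤ s → f s ≤ B) → f (y + b) ≤ B - v * (B - f y)) →
      ∀ (f : ℝ → ℝ) (B y : ℝ), DelayEq F w f → 0 < y →
      (∀ s, y - L ≤ s → f s ≤ B) → f (y + b) ≤ B - u * (B - f y) := by
    intro v u b huv hb h f B y hf hy hB
    have h1 := h f B y hf hy hB
    have h2 : f y ≤ B := hB y (by linarith [hw.L_pos])
    nlinarith
  suffices h : ∃ v : ℝ, 0 < v ∧ v < 1 ∧ ∀ s ∈ Icc T' (T' + L), ∃ b : ℝ, |s - b| < η ∧ 0 ≤ b ∧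
      ∀ (f : ℝ → ℝ) (B y : ℝ), DelayEq F w f → 0 < y →
      (∀ s, y - L ≤ s → f s ≤ B) → f (y + b) ≤ B - v * (B - f y) by
    obtain ⟨v, h1, h2, h⟩ := h
    refine ⟨v, h1, h2, fun s hs => ?_⟩
    obtain ⟨b, hb, _, h⟩ := h s hs
    exact ⟨b, hb, h⟩
  refine hcomp.induction_on (p := fun K => ∃ v : ℝ, 0 < v ∧ v < 1 ∧ ∀ s ∈ K, ∃ b : ℝ,
      |s - b| < η ∧ 0 ≤ b ∧ ∀ (f : ℝ → ℝ) (B y : ℝ), DelayEq F w f → 0 < y →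
      (∀ s, y - L ≤ s → f s ≤ B) → f (y + b) ≤ B - v * (B - f y)) ?_ ?_ ?_ ?_
  · exact ⟨1 / 2, by norm_num, by norm_num, by simp⟩
  · rintro s t hst ⟨v, h1, h2, h⟩
    exact ⟨v, h1, h2, fun x hx => h x (hst hx)⟩
  · rintro s t ⟨v, h1, h2, h⟩ ⟨v', h1', h2', h'⟩
    refine ⟨min v v', lt_min h1 h1', (min_le_left _ _).trans_lt h2, ?_⟩
    rintro x (hx | hx)
    · obtain ⟨b, hb, hb0, h⟩ := h x hx
      exact ⟨b, hb, hb0, hmono (min_le_left _ _) hb0 h⟩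
    · obtain ⟨b, hb, hb0, h⟩ := h' x hx
      exact ⟨b, hb, hb0, hmono (min_le_right _ _) hb0 h⟩
  · intro x hx
    obtain ⟨b, hbS, hb⟩ := hT x ((le_max_left _ _).trans hx.1)
    obtain ⟨hb0, v, hv, h⟩ := hw.path_bound hbS
    refine ⟨{s | |s - b| < η}, mem_nhdsWithin_of_mem_nhds ?_, min v (1 / 2),
      lt_min hv (by norm_num), (min_le_right _ _).trans_lt (by norm_num), fun s hs =>
      ⟨b, hs, hb0, hmono (min_le_left _ _) hb0 h⟩⟩
    exact (isOpen_lt (by fun_prop) continuous_const).mem_nhds hb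

/-- One-sided contraction: if `f ≤ B` and `f` is well below `B` at one point, then `f` is
eventually below `B` by a definite amount. -/
lemma upper_contraction (hw : IsStepLaw F w a L)
    (hd : Dense (AddSubgroup.closure (F : Set ℝ) : Set ℝ)) {η : ℝ} (hη : 0 < η) (hη1 : η ≤ 1) :
    ∃ T v : ℝ, 0 < T ∧ 0 < v ∧ v < 1 ∧ ∀ (f : ℝ → ℝ) (B c τ : ℝ), DelayEq F w f →
      (∀ s t, |f s - f t| ≤ 2 * |s - t|) → 0 ≤ τ → (∀ s, τ ≤ s → f s ≤ B) →
      f (τ + 1 + L) ≤ B - c → ∀ t, τ + T ≤ t → f t ≤ B - v * (c - 2 * η) := by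
  obtain ⟨T, v, hT, hv, hv1, h⟩ := hw.uniform_path_bound hd hη
  have hL := hw.L_pos
  -- The reference point τ + 1 + L leaves room: t - b lies within η ≤ 1 of it, so t - b - L ≥ τ,
  -- where f ≤ B is known. The Lipschitz bound costs 2η.
  refine ⟨1 + L + T, v, by positivity, hv, hv1, fun f B c τ hf hlip hτ hB hc => ?_⟩
  have hwin : ∀ t, τ + (1 + L + T) ≤ t → t ≤ τ + (1 + L + T) + L → f t ≤ B - v * (c - 2 * η) := by
    intro t h1 h2
    obtain ⟨b, hb, hp⟩ := h (t - (τ + 1 + L)) ⟨by linarith, by linarith⟩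
    have hb' := abs_lt.mp hb
    have hy := hp f B (t - b) hf (by linarith) (fun s hs => hB s (by linarith))
    have hl := hlip (t - b) (τ + 1 + L)
    have e : |t - b - (τ + 1 + L)| = |t - (τ + 1 + L) - b| := by congr 1; ring
    rw [e] at hl
    have hl' := (abs_le.mp hl).2
    rw [sub_add_cancel] at hy
    nlinarith
  intro t ht
  refine hw.max_principle (k := f) (τ := τ + (1 + L + T) + L) (fun t ht => ?_) (fun t h1 h2 => ?_)
    t (by linarith)
  · exact (hf t (by linarith)).le
  · exact hwin t (by linarith) h2

lemma neg_delayEq {f : ℝ → ℝ} (hf : DelayEq F w f) : DelayEq F w (fun t => -f t) := by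
  intro t ht
  simp [hf t ht]

/-- Lipschitz solutions of the delay equation have vanishing oscillation, uniformly. -/
lemma oscillation (hw : IsStepLaw F w a L)
    (hd : Dense (AddSubgroup.closure (F : Set ℝ) : Set ℝ)) (M : ℝ) {δ : ℝ} (hδ : 0 < δ) :
    ∃ T : ℝ, 0 < T ∧ ∀ (f : ℝ → ℝ), DelayEq F w f → (∀ s t, |f s - f t| ≤ 2 * |s - t|) →
      (∀ s, 0 ≤ s → |f s| ≤ M) → ∀ s t, T ≤ s → T ≤ t → |f s - f t| ≤ δ := by
  obtain ⟨T, v, hT, hv, hv1, h⟩ := hw.upper_contraction hd (η := min (δ / 8) 1)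
    (lt_min (by positivity) one_pos) (min_le_right _ _)
  have hη : min (δ / 8) 1 ≤ δ / 8 := min_le_left _ _
  -- For Δ ≥ δ and η ≤ δ/8, the gain v(Δ/2 - 2η) is at least vΔ/4.
  set ρ := 1 - v / 4 with hρ
  have step : ∀ (f : ℝ → ℝ), DelayEq F w f → (∀ s t, |f s - f t| ≤ 2 * |s - t|) →
      ∀ τ A Δ : ℝ, 0 ≤ τ → δ ≤ Δ → (∀ s, τ ≤ s → A ≤ f s ∧ f s ≤ A + Δ) →
      ∃ A', ∀ s, τ + T ≤ s → A' ≤ f s ∧ f s ≤ A' + ρ * Δ := by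
    intro f hf hlip τ A Δ hτ hΔ hb
    -- At the test point f lies in one half of its band; the contraction applies to f or to -f
    -- accordingly.
    rcases le_total (f (τ + 1 + L)) (A + Δ / 2) with h1 | h1
    · refine ⟨A, fun s hs => ⟨(hb s (by linarith)).1, ?_⟩⟩
      have := h f (A + Δ) (Δ / 2) τ hf hlip hτ (fun s hs => (hb s hs).2) (by linarith) s hs
      rw [hρ]
      nlinarith
    · refine ⟨A + v / 4 * Δ, fun s hs => ⟨?_, ?_⟩⟩
      · have := h (fun t => -f t) (-A) (Δ / 2) τ (neg_delayEq hf)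
          (fun s t => by rw [← abs_neg]; convert hlip s t using 2; ring) hτ
          (fun s hs => by linarith [(hb s hs).1]) (by linarith) s hs
        nlinarith
      · have := (hb s (by linarith)).2
        rw [hρ]
        linarith
  have iter : ∀ n : ℕ, ∀ (f : ℝ → ℝ), DelayEq F w f → (∀ s t, |f s - f t| ≤ 2 * |s - t|) →
      (∀ s, 0 ≤ s → |f s| ≤ M) →
      ∃ A, ∀ s, n * T ≤ s → A ≤ f s ∧ f s ≤ A + max δ (ρ ^ n * (2 * M)) := by
    intro n f hf hlip hM
    induction n with
    | zero =>
      refine ⟨-M, fun s hs => ?_⟩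
      have := abs_le.mp (hM s (by simpa using hs))
      refine ⟨this.1, ?_⟩
      have := le_max_right δ (ρ ^ 0 * (2 * M))
      simp only [pow_zero, one_mul] at this ⊢
      linarith
    | succ n ih =>
      obtain ⟨A, hA⟩ := ih
      obtain ⟨A', hA'⟩ := step f hf hlip (n * T) A _ (by positivity) (le_max_left _ _) hA
      refine ⟨A', fun s hs => ?_⟩
      obtain ⟨h1, h2⟩ := hA' s (by push_cast at hs; linarith)
      refine ⟨h1, h2.trans ?_⟩
      have hρ0 : 0 ≤ ρ := by linarith
      have hρ1 : ρ ≤ 1 := by linarith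
      rw [mul_max_of_nonneg _ _ hρ0, pow_succ, mul_comm (ρ ^ n) ρ, mul_assoc]
      gcongr
      nlinarith
  obtain ⟨n, hn⟩ : ∃ n : ℕ, ρ ^ n * (2 * M) ≤ δ := by
    have : Tendsto (fun n : ℕ => ρ ^ n * (2 * M)) atTop (𝓝 (0 * (2 * M))) :=
      (tendsto_pow_atTop_nhds_zero_of_lt_one (by linarith) (by linarith)).mul_const _
    rw [zero_mul] at this
    exact (this.eventually (eventually_le_nhds hδ)).exists
  refine ⟨n * T + 1, by positivity, fun f hf hlip hM s t hs ht => ?_⟩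
  obtain ⟨A, hA⟩ := iter n f hf hlip hM
  rw [max_eq_left hn] at hA
  have h1 := hA s (by linarith)
  have h2 := hA t (by linarith)
  rw [abs_le]
  constructor <;> linarith [h1.1, h1.2, h2.1, h2.2]

end IsStepLaw
-- Construction of solutions from initial data
/-- The solution of the delay equation with initial datum `g(-t)`, after `n` unfoldings. -/
noncomputable def solAux (F : Finset ℝ) (w g : ℝ → ℝ) : ℕ → ℝ → ℝ
  | 0, t => g (-t)
  | n + 1, t => if t ≤ 0 then g (-t) else ∑ x ∈ F, w x * solAux F w g n (t - x)

/-- The solution of the delay equation with `f(t) = g(-t)` for `t ≤ 0`. -/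
noncomputable def sol (F : Finset ℝ) (w : ℝ → ℝ) (a : ℝ) (g : ℝ → ℝ) (t : ℝ) : ℝ :=
  solAux F w g ⌈t / a⌉₊ t

/-- The mean step. -/
noncomputable def mean (F : Finset ℝ) (w : ℝ → ℝ) : ℝ := ∑ x ∈ F, w x * x

/-- The integral of `g` against the tail function of the step law. -/
noncomputable def tailIntegral (F : Finset ℝ) (w g : ℝ → ℝ) : ℝ :=
  ∑ x ∈ F, w x * ∫ s in (0 : ℝ)..x, g s

lemma solAux_measurable {g : ℝ → ℝ} (hg : Measurable g) (n : ℕ) :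
    Measurable (solAux F w g n) := by
  induction n with
  | zero => exact hg.comp measurable_neg
  | succ n ih =>
    refine Measurable.ite measurableSet_Iic (hg.comp measurable_neg) ?_
    exact Finset.measurable_fun_sum F fun x _ => (ih.comp (measurable_id.sub_const x)).const_mul _

lemma indicator_nonneg' (e x : ℝ) : 0 ≤ (Ico (0 : ℝ) e).indicator (fun _ => (1 : ℝ)) x :=
  indicator_nonneg (fun _ _ => zero_le_one) x

lemma abs_indicator_le (e x : ℝ) : |(Ico (0 : ℝ) e).indicator (fun _ => (1 : ℝ)) x| ≤ 1 := by
  by_cases h : x ∈ Ico (0 : ℝ) e <;> simp [h]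

lemma measurable_indicator_Ico (e : ℝ) :
    Measurable ((Ico (0 : ℝ) e).indicator (fun _ => (1 : ℝ))) :=
  measurable_const.indicator measurableSet_Ico

namespace IsStepLaw

/-- Each unfolding lowers the argument by at least a, so n of them bring any t ≤ n a to the initial
half-line. Hence the ceiling of t / a suffices in `sol`. -/
lemma solAux_stable (hw : IsStepLaw F w a L) (g : ℝ → ℝ) (n : ℕ) :
    ∀ t, t ≤ n * a → ∀ m, n ≤ m → solAux F w g m t = solAux F w g n t := by
  induction n with
  | zero =>
    intro t ht m _
    have ht : t ≤ 0 := by simpa using ht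
    cases m <;> simp [solAux, ht]
  | succ n ih =>
    intro t ht m hm
    obtain ⟨m, rfl⟩ : ∃ k, m = k + 1 := ⟨m - 1, by omega⟩
    simp only [solAux]
    split_ifs with h
    · rfl
    · refine Finset.sum_congr rfl fun x hx => ?_
      push_cast at ht
      rw [ih (t - x) (by linarith [hw.min_le x hx]) m (by omega)]

lemma sol_eq (hw : IsStepLaw F w a L) (g : ℝ → ℝ) {n : ℕ} {t : ℝ} (h : t ≤ n * a) :
    sol F w a g t = solAux F w g n t := by
  refine (hw.solAux_stable g _ t ?_ n ?_).symm
  · rw [← div_le_iff₀ hw.min_pos]; exact Nat.le_ceil _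
  · rw [Nat.ceil_le, div_le_iff₀ hw.min_pos]; exact h

lemma sol_of_nonpos (hw : IsStepLaw F w a L) (g : ℝ → ℝ) {t : ℝ} (h : t ≤ 0) :
    sol F w a g t = g (-t) := by
  rw [hw.sol_eq g (n := 0) (by simpa using h)]; rfl

lemma sol_delayEq (hw : IsStepLaw F w a L) (g : ℝ → ℝ) : DelayEq F w (sol F w a g) := by
  intro t ht
  obtain ⟨n, hn⟩ := hw.exists_nat_mul_ge t
  have ha := hw.min_pos
  rw [hw.sol_eq g (n := n + 1) (by push_cast; linarith)]
  simp only [solAux, not_le.mpr ht, if_false]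
  refine Finset.sum_congr rfl fun x hx => ?_
  rw [hw.sol_eq g (n := n) (by linarith [hw.x_pos hx])]

lemma sol_measurable (hw : IsStepLaw F w a L) {g : ℝ → ℝ} (hg : Measurable g) :
    Measurable (sol F w a g) := by
  refine measurable_of_tendsto_metrizable (f := fun n : ℕ => solAux F w g n)
    (solAux_measurable hg) ?_
  rw [tendsto_pi_nhds]
  intro t
  obtain ⟨n, hn⟩ := hw.exists_nat_mul_ge t
  refine tendsto_const_nhds.congr' ?_
  filter_upwards [eventually_ge_atTop n] with m hm
  rw [hw.sol_eq g hn, hw.solAux_stable g n t hn m hm]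

/-- Maximum principle for `sol`, on the whole line. -/
lemma sol_le (hw : IsStepLaw F w a L) {g : ℝ → ℝ} {B : ℝ} (hg : ∀ x, 0 ≤ x → g x ≤ B) (t : ℝ) :
    sol F w a g t ≤ B := by
  have h0 : ∀ t, t ≤ 0 → sol F w a g t ≤ B := fun t ht => by
    rw [hw.sol_of_nonpos g ht]; exact hg _ (by linarith)
  rcases le_or_gt t 0 with ht | ht
  · exact h0 t ht
  · exact hw.max_principle (τ := 0) (fun t ht => (hw.sol_delayEq g t ht).le) (fun t _ h => h0 t h) t
      (by linarith [hw.L_pos])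

lemma le_sol (hw : IsStepLaw F w a L) {g : ℝ → ℝ} {B : ℝ} (hg : ∀ x, 0 ≤ x → B ≤ g x) (t : ℝ) :
    B ≤ sol F w a g t := by
  have h0 : ∀ t, t ≤ 0 → B ≤ sol F w a g t := fun t ht => by
    rw [hw.sol_of_nonpos g ht]; exact hg _ (by linarith)
  rcases le_or_gt t 0 with ht | ht
  · exact h0 t ht
  · have := hw.max_principle (τ := 0) (B := -B)
      (fun t ht => (neg_delayEq (hw.sol_delayEq g) t ht).le)
      (fun t _ h => neg_le_neg (h0 t h)) t (by linarith [hw.L_pos])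
    linarith

lemma abs_sol_le (hw : IsStepLaw F w a L) {g : ℝ → ℝ} (hg : ∀ x, |g x| ≤ 1) (t : ℝ) :
    |sol F w a g t| ≤ 1 :=
  abs_le.mpr ⟨hw.le_sol (fun x _ => (abs_le.mp (hg x)).1) t,
    hw.sol_le (fun x _ => (abs_le.mp (hg x)).2) t⟩

lemma mean_pos (hw : IsStepLaw F w a L) : 0 < mean F w :=
  Finset.sum_pos (fun x hx => mul_pos (hw.pos x hx) (hw.x_pos hx)) hw.nonempty

lemma abs_tailIntegral_le (hw : IsStepLaw F w a L) {g : ℝ → ℝ} (hg : ∀ x, |g x| ≤ 1) :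
    |tailIntegral F w g| ≤ mean F w := by
  refine (Finset.abs_sum_le_sum_abs _ _).trans (Finset.sum_le_sum fun x hx => ?_)
  rw [abs_mul, abs_of_pos (hw.pos x hx)]
  refine mul_le_mul_of_nonneg_left ?_ (hw.pos x hx).le
  have := intervalIntegral.norm_integral_le_of_norm_le_const (a := 0) (b := x) (f := g) (C := 1)
    fun y _ => hg y
  simpa [abs_of_pos (hw.x_pos hx)] using this

lemma abs_ratio_le (hw : IsStepLaw F w a L) {g : ℝ → ℝ} (hg : ∀ x, |g x| ≤ 1) :
    |tailIntegral F w g / mean F w| ≤ 1 := by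
  rw [abs_div, abs_of_pos hw.mean_pos, div_le_one hw.mean_pos]
  exact hw.abs_tailIntegral_le hg

lemma intervalIntegrable_sol (hw : IsStepLaw F w a L) {g : ℝ → ℝ} (hgm : Measurable g)
    (hg : ∀ x, |g x| ≤ 1) (s t : ℝ) : IntervalIntegrable (sol F w a g) volume s t := by
  rw [intervalIntegrable_iff]
  exact Measure.integrableOn_of_bounded (M := 1) (by simp)
    (hw.sol_measurable hgm).aestronglyMeasurable (ae_of_all _ (hw.abs_sol_le hg))

/-! ### Convergence of averages -/

/-- The primitive of the solution satisfies the delay equation up to a constant. -/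
lemma primitive_eq (hw : IsStepLaw F w a L) {g : ℝ → ℝ} (hgm : Measurable g)
    (hg : ∀ x, |g x| ≤ 1) {t : ℝ} (ht : 0 ≤ t) :
    ∫ s in (0 : ℝ)..t, sol F w a g s =
      tailIntegral F w g + ∑ x ∈ F, w x * ∫ s in (0 : ℝ)..(t - x), sol F w a g s := by
  have hi := hw.intervalIntegrable_sol hgm hg
  have h1 : ∫ s in (0 : ℝ)..t, sol F w a g s =
      ∑ x ∈ F, w x * ∫ s in (0 : ℝ)..t, sol F w a g (s - x) := by
    rw [intervalIntegral.integral_congr_ae (g := fun s => ∑ x ∈ F, w x * sol F w a g (s - x))]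
    · rw [intervalIntegral.integral_finsetSum]
      · simp only [intervalIntegral.integral_const_mul]
      · intro x _
        refine IntervalIntegrable.const_mul ?_ _
        have := (hi (0 - x) (t - x)).comp_sub_right x
        simpa using this
    · refine ae_of_all _ fun s hs => ?_
      rw [uIoc_of_le ht] at hs
      exact hw.sol_delayEq g s hs.1
  rw [h1, tailIntegral, ← Finset.sum_add_distrib]
  refine Finset.sum_congr rfl fun x hx => ?_
  rw [← mul_add, intervalIntegral.integral_comp_sub_right (fun s => sol F w a g s) x]
  congr 1
  -- The piece over [-x, 0] involves only the initial datum; it yields the term of `tailIntegral`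
  -- for x.
  rw [← intervalIntegral.integral_add_adjacent_intervals (hi (0 - x) 0) (hi 0 (t - x))]
  congr 1
  have hx0 := hw.x_pos hx
  have : ∫ s in (0 - x)..0, sol F w a g s = ∫ s in (0 - x)..0, g (-s) := by
    refine intervalIntegral.integral_congr fun s hs => ?_
    rw [uIcc_of_le (by linarith)] at hs
    exact hw.sol_of_nonpos g hs.2
  rw [this, intervalIntegral.integral_comp_neg]
  simp

/-- The averages of `sol` over short intervals converge, uniformly in the initial datum. -/
lemma average_tendsto (hw : IsStepLaw F w a L)
    (hd : Dense (AddSubgroup.closure (F : Set ℝ) : Set ℝ)) {δ : ℝ} (hδ : 0 < δ) :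
    ∃ T : ℝ, 0 < T ∧ ∀ g : ℝ → ℝ, Measurable g → (∀ x, |g x| ≤ 1) → ∀ t e, T ≤ t → 0 ≤ e →
      |(∫ s in t..(t + e), sol F w a g s) - e * (tailIntegral F w g / mean F w)| ≤ δ := by
  obtain ⟨T, hT, h⟩ := hw.oscillation hd (2 * L) hδ
  refine ⟨T, hT, fun g hgm hg t e ht he => ?_⟩
  have hi := hw.intervalIntegrable_sol hgm hg
  have hm := hw.abs_ratio_le hg
  set m := tailIntegral F w g / mean F w with hmdef
  -- This slope cancels the constant in `primitive_eq`. As both the solution and m are at most 1 in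
  -- absolute value, D is 2-Lipschitz.
  set D : ℝ → ℝ := fun t => (∫ s in (0 : ℝ)..t, sol F w a g s) - m * t with hD
  have hD0 : ∀ t, 0 ≤ t → D t = ∑ x ∈ F, w x * D (t - x) := by
    intro t ht
    have e1 : ∑ x ∈ F, w x * D (t - x) = (∑ x ∈ F, w x * ∫ s in (0 : ℝ)..(t - x), sol F w a g s) -
        m * t * (∑ x ∈ F, w x) + m * ∑ x ∈ F, w x * x := by
      rw [Finset.mul_sum, Finset.mul_sum, ← Finset.sum_sub_distrib, ← Finset.sum_add_distrib]
      refine Finset.sum_congr rfl fun x _ => ?_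
      simp only [hD]; ring
    have e2 : m * ∑ x ∈ F, w x * x = tailIntegral F w g :=
      div_mul_cancel₀ _ hw.mean_pos.ne'
    rw [e1, e2, hw.sum_eq]
    simp only [hD]
    rw [hw.primitive_eq hgm hg ht]
    ring
  have hlip : ∀ s t, |D s - D t| ≤ 2 * |s - t| := by
    intro s t
    have e1 : D s - D t = (∫ u in t..s, sol F w a g u) - m * (s - t) := by
      simp only [hD]
      rw [← intervalIntegral.integral_add_adjacent_intervals (hi 0 t) (hi t s)]
      ring
    have e2 := intervalIntegral.norm_integral_le_of_norm_le_const (a := t) (b := s)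
      (f := sol F w a g) (C := 1) fun y _ => hw.abs_sol_le hg y
    rw [Real.norm_eq_abs] at e2
    rw [e1]
    refine (abs_sub _ _).trans ?_
    rw [abs_mul]
    nlinarith [abs_nonneg (s - t)]
  have hDz : D 0 = 0 := by simp [hD]
  have hini : ∀ t, 0 - L ≤ t → t ≤ 0 → |D t| ≤ 2 * L := by
    intro t h1 h2
    have := hlip t 0
    rw [hDz, sub_zero, sub_zero, abs_of_nonpos h2] at this
    linarith
  have hbd : ∀ t, 0 ≤ t → |D t| ≤ 2 * L := by
    intro t ht
    have hL := hw.L_pos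
    have u1 := hw.max_principle (k := D) (τ := 0) (fun t ht => (hD0 t ht.le).le)
      (fun t h1 h2 => (abs_le.mp (hini t h1 h2)).2) t (by linarith)
    have u2 := hw.max_principle (k := fun t => -D t) (τ := 0)
      (fun t ht => (neg_delayEq (fun t ht => hD0 t ht.le) t ht).le)
      (fun t h1 h2 => neg_le.mp (abs_le.mp (hini t h1 h2)).1) t (by linarith)
    exact abs_le.mpr ⟨by linarith, u1⟩
  have := h D (fun t ht => hD0 t ht.le) hlip hbd (t + e) t (by linarith) ht
  convert this using 2
  simp only [hD]
  rw [← intervalIntegral.integral_add_adjacent_intervals (hi 0 t) (hi t (t + e))]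
  ring

/-! ### From averages to pointwise values -/

/-- In terms of the walk: a residue below e at level t forces a residue below e + s ≤ 2e at the
lower level t - s. The maximum principle reduces this to initial times. -/
lemma indicator_sol_shift (hw : IsStepLaw F w a L) {e s t : ℝ} (hs : 0 ≤ s) (hse : s ≤ e)
    (ht : s - L ≤ t) :
    sol F w a ((Ico 0 e).indicator fun _ => 1) t ≤
      sol F w a ((Ico 0 (2 * e)).indicator fun _ => 1) (t - s) := by
  set k := sol F w a ((Ico 0 e).indicator fun _ => 1)
  set k' := sol F w a ((Ico 0 (2 * e)).indicator fun _ => 1)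
  have := hw.max_principle (k := fun t => k t - k' (t - s)) (τ := s) (B := 0) ?_ ?_ t ht
  · linarith
  · intro t ht
    have hk : DelayEq F w k := hw.sol_delayEq _
    have hk' : DelayEq F w k' := hw.sol_delayEq _
    rw [hk t (by linarith), hk' (t - s) (by linarith),
      ← Finset.sum_sub_distrib]
    refine (Finset.sum_congr rfl fun x _ => ?_).le
    rw [mul_sub, sub_right_comm t s x]
  · intro t _ ht2
    rw [sub_nonpos]
    rcases lt_or_ge (s - 2 * e) t with h | h
    · have : k' (t - s) = 1 := by
        simp only [k']
        rw [hw.sol_of_nonpos _ (by linarith)]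
        exact indicator_of_mem (show -(t - s) ∈ Ico 0 (2 * e) from ⟨by linarith, by linarith⟩) _
      rw [this]
      exact (abs_le.mp (hw.abs_sol_le (abs_indicator_le e) t)).2
    · have : k t = 0 := by
        simp only [k]
        rw [hw.sol_of_nonpos _ (by linarith)]
        exact indicator_of_notMem (fun hh => by linarith [hh.2]) _
      rw [this]
      exact hw.le_sol (fun x _ => indicator_nonneg' _ x) _

/-- If the residue at t is at least s, both levels are crossed at once and the residues differ by s;
otherwise the difference is at most 2, and the indicator solution pays for it. The factor σ handles
both signs at once. -/
lemma sol_sub_shift_le (hw : IsStepLaw F w a L) {σ : ℝ} (hσ : |σ| ≤ 1) {g : ℝ → ℝ}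
    (hg : ∀ x, |g x| ≤ 1)
    (hgl : ∀ x y, |g x - g y| ≤ |x - y|) {e s t : ℝ} (hs : 0 ≤ s) (hse : s ≤ e) (ht : 0 ≤ t) :
    σ * (sol F w a g t - sol F w a g (t + s)) ≤
      s + 2 * sol F w a ((Ico 0 e).indicator fun _ => 1) t := by
  set h := sol F w a g
  set k := sol F w a ((Ico 0 e).indicator fun _ => 1)
  have hL := hw.L_pos
  have key : ∀ z, σ * z ≤ |z| := fun z => (le_abs_self _).trans (by
    rw [abs_mul]; exact mul_le_of_le_one_left (abs_nonneg z) hσ)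
  have := hw.max_principle (k := fun t => σ * (h t - h (t + s)) - 2 * k t) (τ := 0) (B := s) ?_ ?_
    t (by linarith)
  · linarith
  · intro t ht
    have hh : DelayEq F w h := hw.sol_delayEq _
    have hk : DelayEq F w k := hw.sol_delayEq _
    rw [hh t ht, hh (t + s) (by linarith), hk t ht,
      ← Finset.sum_sub_distrib, Finset.mul_sum, Finset.mul_sum, ← Finset.sum_sub_distrib]
    refine (Finset.sum_congr rfl fun x _ => ?_).le
    rw [add_sub_right_comm t s x]
    ring
  · intro t _ ht2
    have k0 : 0 ≤ k t := hw.le_sol (fun x _ => indicator_nonneg' _ x) _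
    refine (sub_le_sub_right (key _) _).trans ?_
    rcases le_or_gt (t + s) 0 with h1 | h1
    · have : |h t - h (t + s)| ≤ s := by
        simp only [h]
        rw [hw.sol_of_nonpos _ ht2, hw.sol_of_nonpos _ h1]
        refine (hgl _ _).trans ?_
        rw [show -t - -(t + s) = s by ring, abs_of_nonneg hs]
      linarith
    · have : k t = 1 := by
        simp only [k]
        rw [hw.sol_of_nonpos _ ht2]
        exact indicator_of_mem (show -t ∈ Ico 0 e from ⟨by linarith, by linarith⟩) _
      have e1 := abs_sub (h t) (h (t + s))
      have e2 := hw.abs_sol_le hg t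
      have e3 := hw.abs_sol_le hg (t + s)
      simp only [h] at *
      linarith

/-- The value at t is below the solution for [0, 2e) throughout [t - e, t], hence below its average
there, which is nearly the limit and so about 2e / `mean` at most. -/
lemma indicator_sol_le (hw : IsStepLaw F w a L) {e δ T : ℝ} (he : 0 < e)
    (h : ∀ g : ℝ → ℝ, Measurable g → (∀ x, |g x| ≤ 1) → ∀ t e, T ≤ t → 0 ≤ e →
      |(∫ s in t..(t + e), sol F w a g s) - e * (tailIntegral F w g / mean F w)| ≤ δ)
    (hT : 0 ≤ T) {t : ℝ} (ht : T + e ≤ t) :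
    sol F w a ((Ico 0 e).indicator fun _ => 1) t ≤ 2 * e / mean F w + δ / e := by
  have hm := measurable_indicator_Ico (2 * e)
  have hb := abs_indicator_le (2 * e)
  have h1 := h _ hm hb (t - e) e (by linarith) he.le
  rw [sub_add_cancel] at h1
  set q : ℝ → ℝ := (Ico 0 (2 * e)).indicator fun _ => 1 with hq
  set y := sol F w a ((Ico 0 e).indicator fun _ => 1) t
  have h2 : e * y ≤ ∫ s in (t - e)..t, sol F w a q s := by
    have := intervalIntegral.integral_mono_on (a := t - e) (b := t) (μ := volume)
      (f := fun _ => y) (g := sol F w a q) (by linarith)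
      intervalIntegrable_const (hw.intervalIntegrable_sol hm hb _ _) (fun s hs => ?_)
    · simpa using this
    · have := hw.indicator_sol_shift (e := e) (s := t - s) (t := t) (by linarith [hs.2])
        (by linarith [hs.1]) (by linarith [hs.1, hw.L_pos])
      simpa using this
  have h3 : tailIntegral F w q ≤ 2 * e := by
    refine hw.sum_mul_le fun x hx => ?_
    rw [intervalIntegral.integral_of_le (hw.x_pos hx).le]
    rw [hq, setIntegral_indicator measurableSet_Ico, setIntegral_const, smul_eq_mul, mul_one]
    have : volume.real (Ioc 0 x ∩ Ico 0 (2 * e)) ≤ volume.real (Ico 0 (2 * e)) :=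
      measureReal_mono inter_subset_right measure_Ico_lt_top.ne
    refine this.trans ?_
    simp [he.le]
  have h4 : tailIntegral F w q / mean F w ≤ 2 * e / mean F w :=
    div_le_div_of_nonneg_right h3 hw.mean_pos.le
  have h5 := (abs_le.mp h1).2
  have h6 : e * y ≤ e * (2 * e / mean F w + δ / e) := by
    have : e * (δ / e) = δ := mul_div_cancel₀ _ he.ne'
    nlinarith
  exact le_of_mul_le_mul_left h6 he

/-- The renewal theorem for the delay equation, uniformly over bounded Lipschitz data. -/
theorem sol_tendsto (hw : IsStepLaw F w a L)
    (hd : Dense (AddSubgroup.closure (F : Set ℝ) : Set ℝ)) {ε : ℝ} (hε : 0 < ε) :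
    ∃ T : ℝ, ∀ g : ℝ → ℝ, (∀ x, |g x| ≤ 1) → (∀ x y, |g x - g y| ≤ |x - y|) → ∀ t, T ≤ t →
      |sol F w a g t - tailIntegral F w g / mean F w| ≤ ε := by
  have hσ := hw.mean_pos
  -- With δ = e² the averaging error is e and the indicator value y is at most 2e / `mean` + e; then
  -- (e + 2y) + e is at most ε.
  set e := ε / (4 + 4 / mean F w) with he_def
  have hden : 0 < 4 + 4 / mean F w := by positivity
  have he : 0 < e := by positivity
  have hεe : ε = 4 * e + 2 * (2 * e / mean F w) := by
    have : ε = e * (4 + 4 / mean F w) := by rw [he_def, div_mul_cancel₀ _ hden.ne']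
    rw [this]; ring
  obtain ⟨T, hT, h⟩ := hw.average_tendsto hd (δ := e * e) (by positivity)
  refine ⟨T + e, fun g hg hgl t ht => ?_⟩
  have hgm : Measurable g := by
    have : LipschitzWith 1 g := LipschitzWith.of_dist_le_mul fun x y => by
      simpa [Real.dist_eq] using hgl x y
    exact this.continuous.measurable
  have hk := hw.indicator_sol_le he h hT.le ht
  rw [mul_div_assoc e e e, div_self he.ne', mul_one] at hk
  set y := sol F w a ((Ico 0 e).indicator fun _ => 1) t
  have h1 := h g hgm hg t e (by linarith) he.le
  have h2 : |e * sol F w a g t - ∫ s in t..(t + e), sol F w a g s| ≤ e * (e + 2 * y) := by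
    have e1 : e * sol F w a g t - ∫ s in t..(t + e), sol F w a g s =
        ∫ s in t..(t + e), (sol F w a g t - sol F w a g s) := by
      rw [intervalIntegral.integral_sub intervalIntegrable_const
        (hw.intervalIntegrable_sol hgm hg _ _)]
      simp
    rw [e1]
    have := intervalIntegral.norm_integral_le_of_norm_le_const (a := t) (b := t + e)
      (f := fun s => sol F w a g t - sol F w a g s) (C := e + 2 * y) (fun s hs => ?_)
    · rw [Real.norm_eq_abs] at this
      rw [add_sub_cancel_left, abs_of_pos he] at this
      linarith
    · rw [uIoc_of_le (by linarith)] at hs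
      have ht0 : 0 ≤ t := by linarith
      have a1 := hw.sol_sub_shift_le (σ := 1) (by simp) hg hgl (e := e) (s := s - t) (t := t)
        (by linarith [hs.1]) (by linarith [hs.2]) ht0
      have a2 := hw.sol_sub_shift_le (σ := -1) (by simp) hg hgl (e := e) (s := s - t) (t := t)
        (by linarith [hs.1]) (by linarith [hs.2]) ht0
      rw [add_sub_cancel] at a1 a2
      rw [Real.norm_eq_abs, abs_le]
      constructor <;> linarith [hs.1, hs.2]
  set m := tailIntegral F w g / mean F w
  have h3 : e * |sol F w a g t - m| ≤ e * ε := by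
    rw [← abs_of_pos he, ← abs_mul, abs_of_pos he]
    have : e * (sol F w a g t - m) = (e * sol F w a g t - ∫ s in t..(t + e), sol F w a g s) +
        ((∫ s in t..(t + e), sol F w a g s) - e * m) := by ring
    rw [this]
    refine (abs_add_le _ _).trans ((add_le_add h2 h1).trans ?_)
    nlinarith
  exact le_of_mul_le_mul_left h3 he

/-- A uniform rate of convergence in the renewal theorem. -/
theorem exists_rate (hw : IsStepLaw F w a L)
    (hd : Dense (AddSubgroup.closure (F : Set ℝ) : Set ℝ)) :
    ∃ o : ℝ → ℝ, Tendsto o atTop (𝓝 0) ∧ ∀ g : ℝ → ℝ, (∀ x, |g x| ≤ 1) →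
      (∀ x y, |g x - g y| ≤ |x - y|) → ∀ t,
      |sol F w a g t - tailIntegral F w g / mean F w| ≤ o t := by
  -- The rate is the supremum of the error over all admissible data; it tends to 0 because the
  -- threshold in `sol_tendsto` does not depend on g.
  let G := {g : ℝ → ℝ // (∀ x, |g x| ≤ 1) ∧ ∀ x y, |g x - g y| ≤ |x - y|}
  have : Nonempty G := ⟨⟨fun _ => 0, by simp, by simp⟩⟩
  let A : ℝ → G → ℝ := fun t g => |sol F w a g.1 t - tailIntegral F w g.1 / mean F w|
  have hbdd : ∀ t, BddAbove (range (A t)) := by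
    refine fun t => ⟨2, ?_⟩
    rintro _ ⟨g, rfl⟩
    refine (abs_sub _ _).trans ?_
    linarith [hw.abs_sol_le g.2.1 t, hw.abs_ratio_le g.2.1]
  refine ⟨fun t => ⨆ g, A t g, ?_, fun g h1 h2 t => le_ciSup (hbdd t) ⟨g, h1, h2⟩⟩
  rw [Metric.tendsto_atTop]
  intro ε hε
  obtain ⟨T, hT⟩ := hw.sol_tendsto hd (half_pos hε)
  refine ⟨T, fun t ht => ?_⟩
  have h0 : 0 ≤ ⨆ g, A t g := Real.iSup_nonneg fun g => abs_nonneg _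
  rw [Real.dist_eq, sub_zero, abs_of_nonneg h0]
  refine lt_of_le_of_lt (ciSup_le fun g => ?_) (half_lt_self hε)
  exact hT g.1 g.2.1 g.2.2 t ht

end IsStepLaw
end DelayEquation

/-! ### Finitely supported laws and their tails -/

section Measure

variable {lam : Measure ℝ}

lemma measure_eq_zero_of_disjoint_support {s : Set ℝ} (h : Disjoint s lam.support) :
    lam s = 0 :=
  measure_mono_null (fun _ hx hx' => disjoint_left.mp h hx hx') Measure.measure_compl_support

/-- Deleting the other support points leaves a neighbourhood of x, whose positive mass can only sit
at x. -/
lemma real_singleton_pos [IsProbabilityMeasure lam] (hfin : lam.support.Finite) {x : ℝ}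
    (hx : x ∈ lam.support) : 0 < lam.real {x} := by
  have h1 : (lam.support \ {x})ᶜ ∈ 𝓝 x :=
    (hfin.subset sdiff_subset).isClosed.isOpen_compl.mem_nhds (by simp)
  have h2 := (Measure.mem_support_iff_forall x).mp hx _ h1
  have h3 : lam (lam.support \ {x})ᶜ ≤ lam {x} + lam lam.supportᶜ := by
    refine (measure_mono fun y hy => ?_).trans (measure_union_le _ _)
    by_cases h : y ∈ lam.support
    · left; by_contra h'; exact hy ⟨h, h'⟩
    · right; exact h
  rw [Measure.measure_compl_support, add_zero] at h3
  exact ENNReal.toReal_pos (h2.trans_le h3).ne' (measure_ne_top _ _)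

lemma integral_eq_sum_support [IsProbabilityMeasure lam] (hfin : lam.support.Finite) (f : ℝ → ℝ) :
    ∫ x, f x ∂lam = ∑ x ∈ hfin.toFinset, lam.real {x} * f x := by
  have h : lam.restrict (hfin.toFinset : Set ℝ) = lam := by
    rw [hfin.coe_toFinset]
    exact Measure.restrict_eq_self_of_ae_mem Measure.support_mem_ae
  conv_lhs => rw [← h]
  rw [setIntegral_finset]
  · simp
  · exact IntegrableOn.finset

lemma le_suppBound (hfin : lam.support.Finite) {x : ℝ} (hx : x ∈ lam.support) :
    x ≤ suppBound lam :=
  (le_abs_self x).trans (le_csSup (hfin.image _).bddAbove (mem_image_of_mem _ hx))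

lemma exists_isStepLaw [IsProbabilityMeasure lam] (hpos : ∀ᵐ x ∂lam, 0 < x)
    (hfin : lam.support.Finite) :
    ∃ a, IsStepLaw hfin.toFinset (fun x => lam.real {x}) a (suppBound lam) := by
  have h1 := integral_eq_sum_support hfin (fun _ => 1)
  simp only [integral_const, probReal_univ, smul_eq_mul, mul_one] at h1
  have hne : hfin.toFinset.Nonempty := by
    by_contra h
    rw [Finset.not_nonempty_iff_eq_empty.mp h] at h1
    simp at h1
  have hx0 : ∀ x ∈ lam.support, 0 < x := by
    intro x hx
    by_contra h
    have h2 : lam {x} = 0 := measure_mono_null (fun y hy => by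
      rw [mem_singleton_iff] at hy; subst hy; exact h) (ae_iff.mp hpos)
    have h3 := real_singleton_pos hfin hx
    simp [measureReal_def, h2] at h3
  refine ⟨hfin.toFinset.min' hne, fun x hx => real_singleton_pos hfin (hfin.mem_toFinset.mp hx),
    h1.symm, ?_, fun x hx => Finset.min'_le _ _ hx,
    fun x hx => le_suppBound hfin (hfin.mem_toFinset.mp hx)⟩
  exact hx0 _ (hfin.mem_toFinset.mp (Finset.min'_mem _ hne))

lemma tail_isPiecewiseConstant [IsProbabilityMeasure lam] (hfin : lam.support.Finite) :
    IsPiecewiseConstant (tail lam) := by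
  refine ⟨lam.support, hfin, fun x y hxy h => ?_⟩
  have h0 : lam (Ioc x y) = 0 :=
    measure_eq_zero_of_disjoint_support (h.mono_left Ioc_subset_Icc_self)
  simp only [tail, measureReal_def]
  rw [← Ioc_union_Ioi_eq_Ioi hxy, measure_union (Ioc_disjoint_Ioi le_rfl) measurableSet_Ioi, h0,
    zero_add]

lemma tail_eq_zero (hfin : lam.support.Finite) {x : ℝ} (hx : suppBound lam ≤ x) :
    tail lam x = 0 := by
  have : lam (Ioi x) = 0 := measure_eq_zero_of_disjoint_support <| disjoint_left.mpr
    fun y hy hy' => absurd (le_suppBound hfin hy') (by have := mem_Ioi.mp hy; linarith)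
  simp [tail, measureReal_def, this]

lemma tail_eq_sum [IsProbabilityMeasure lam] (hfin : lam.support.Finite) (y : ℝ) :
    tail lam y = ∑ x ∈ hfin.toFinset, lam.real {x} * (Iio x).indicator (fun _ => 1) y := by
  have h := integral_eq_sum_support hfin ((Ioi y).indicator fun _ => 1)
  rw [integral_indicator_const _ measurableSet_Ioi, smul_eq_mul, mul_one] at h
  rw [tail, h]
  refine Finset.sum_congr rfl fun x _ => ?_
  simp only [indicator, mem_Ioi, mem_Iio]

lemma integral_mul_tail [IsProbabilityMeasure lam] (hpos : ∀ᵐ x ∂lam, 0 < x)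
    (hfin : lam.support.Finite) {g : ℝ → ℂ}
    (hg : Continuous g) :
    IntegrableOn (fun y => g y * (tail lam y : ℂ)) (Ioi 0) ∧
    ∫ y in Ioi (0 : ℝ), g y * (tail lam y : ℂ) =
      ∑ x ∈ hfin.toFinset, lam.real {x} • ∫ y in (0 : ℝ)..x, g y := by
  obtain ⟨a, hw⟩ := exists_isStepLaw hpos hfin
  have e : (fun y => g y * (tail lam y : ℂ)) =
      fun y => ∑ x ∈ hfin.toFinset, lam.real {x} • (Iio x).indicator g y := by
    funext y
    rw [tail_eq_sum hfin, Complex.ofReal_sum, Finset.mul_sum]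
    refine Finset.sum_congr rfl fun x _ => ?_
    by_cases h : y ∈ Iio x
    · simp only [indicator_of_mem h, Complex.real_smul, mul_one]; ring
    · simp only [indicator_of_notMem h, mul_zero, smul_zero, Complex.ofReal_zero]
  have hi : ∀ x ∈ hfin.toFinset,
      Integrable (fun y => lam.real {x} • (Iio x).indicator g y) (volume.restrict (Ioi 0)) := by
    intro x _
    refine Integrable.smul (𝕜 := ℝ) (lam.real {x}) ?_
    rw [integrable_indicator_iff measurableSet_Iio, IntegrableOn,
      Measure.restrict_restrict measurableSet_Iio]
    exact (hg.integrableOn_Icc (a := 0) (b := x)).mono_set fun y hy => ⟨hy.2.le, hy.1.le⟩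
  refine ⟨?_, ?_⟩
  · rw [e, IntegrableOn]
    exact integrable_finsetSum _ hi
  · rw [e, integral_finsetSum _ hi]
    refine Finset.sum_congr rfl fun x hx => ?_
    rw [integral_smul, setIntegral_indicator measurableSet_Iio, Ioi_inter_Iio,
      intervalIntegral.integral_of_le (hw.x_pos hx).le, integral_Ioc_eq_integral_Ioo]

end Measure

/-! ### The walk and its residue along one path -/

section Pathwise

variable {Ω : Type*} {X : ℕ → Ω → ℝ} {ω : Ω} {a L t : ℝ}

lemma partialSum_succ (n : ℕ) : partialSum X (n + 1) ω = partialSum X n ω + X n ω :=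
  Finset.sum_range_succ _ _

lemma partialSum_succ' (n : ℕ) :
    partialSum X (n + 1) ω = X 0 ω + partialSum (fun i => X (i + 1)) n ω := by
  rw [partialSum, Finset.sum_range_succ', add_comm]; rfl

lemma nat_mul_le_partialSum (h : ∀ i, a ≤ X i ω) (n : ℕ) : n * a ≤ partialSum X n ω := by
  induction n with
  | zero => simp [partialSum]
  | succ n ih => rw [partialSum_succ]; push_cast; linarith [h n]

lemma exists_le_partialSum (ha : 0 < a) (h : ∀ i, a ≤ X i ω) (t : ℝ) :
    ∃ n, t ≤ partialSum X n ω := by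
  obtain ⟨n, hn⟩ := exists_nat_ge (t / a)
  rw [div_le_iff₀ ha] at hn
  exact ⟨n, hn.trans (nat_mul_le_partialSum h n)⟩

lemma residue_of_nonpos (ht : t ≤ 0) : residue X t ω = -t := by
  have : stoppingTime X t ω = 0 := Nat.sInf_eq_zero.mpr (Or.inl (by simpa [partialSum] using ht))
  simp [residue, this, partialSum]

lemma stoppingTime_eq_succ (ht : 0 < t) (h : ∃ n, t ≤ partialSum X n ω) :
    stoppingTime X t ω = stoppingTime (fun i => X (i + 1)) (t - X 0 ω) ω + 1 := by
  have h0 : ¬ t ≤ partialSum X 0 ω := by simpa [partialSum] using ht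
  have hiff : ∀ n, t ≤ partialSum X (n + 1) ω ↔
      t - X 0 ω ≤ partialSum (fun i => X (i + 1)) n ω := fun n => by
    rw [partialSum_succ', sub_le_iff_le_add']
  have hpos : 1 ≤ sInf {n | t ≤ partialSum X n ω} := by
    rw [Nat.one_le_iff_ne_zero]
    intro h1
    have := Nat.sInf_mem (s := {n | t ≤ partialSum X n ω}) h
    rw [h1] at this
    exact h0 this
  rw [stoppingTime, stoppingTime, ← Nat.sInf_add hpos]
  simp only [hiff]

lemma residue_eq_shift (ht : 0 < t) (h : ∃ n, t ≤ partialSum X n ω) :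
    residue X t ω = residue (fun i => X (i + 1)) (t - X 0 ω) ω := by
  rw [residue, residue, stoppingTime_eq_succ ht h, partialSum_succ']
  ring

/-- Just before stopping the sum is below t, and the last step adds at most L. -/
lemma residue_mem_Icc (ht : 0 < t) (hL : ∀ i, X i ω ≤ L) (h : ∃ n, t ≤ partialSum X n ω) :
    residue X t ω ∈ Icc 0 L := by
  have h1 : t ≤ partialSum X (stoppingTime X t ω) ω :=
    Nat.sInf_mem (s := {n | t ≤ partialSum X n ω}) h
  refine ⟨sub_nonneg.mpr h1, ?_⟩
  rw [residue]
  cases hn : stoppingTime X t ω with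
  | zero => rw [hn] at h1; simp [partialSum] at h1; linarith
  | succ n =>
    have : ¬ t ≤ partialSum X n ω :=
      Nat.notMem_of_lt_sInf (s := {n | t ≤ partialSum X n ω})
        (show n < stoppingTime X t ω by omega)
    rw [partialSum_succ]
    linarith [hL n]

variable [MeasurableSpace Ω]

lemma measurable_partialSum (hX : ∀ i, Measurable (X i)) (n : ℕ) : Measurable (partialSum X n) :=
  Finset.measurable_fun_sum _ fun i _ => hX i

lemma measurable_stoppingTime (hX : ∀ i, Measurable (X i)) (t : ℝ) :
    Measurable (stoppingTime X t) := by
  have hm : ∀ n, MeasurableSet {ω | t ≤ partialSum X n ω} := fun n =>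
    measurableSet_le measurable_const (measurable_partialSum hX n)
  refine measurable_of_Ioi fun n => ?_
  -- The union is needed because the stopping time is 0 when the level is never reached.
  have : stoppingTime X t ⁻¹' Ioi n =
      (⋂ m ∈ Iic n, {ω | t ≤ partialSum X m ω}ᶜ) ∩ ⋃ m, {ω | t ≤ partialSum X m ω} := by
    ext ω
    simp only [mem_preimage, mem_Ioi, mem_inter_iff, mem_iInter, mem_iUnion, mem_compl_iff,
      mem_ofPred_eq, mem_Iic]
    constructor
    · intro h
      refine ⟨fun m hm => Nat.notMem_of_lt_sInf (s := {n | t ≤ partialSum X n ω})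
        (show m < stoppingTime X t ω by omega), ?_⟩
      by_contra! h'
      have : {n | t ≤ partialSum X n ω} = ∅ := by
        ext m; simpa using h' m
      rw [stoppingTime, this, Nat.sInf_empty] at h
      omega
    · rintro ⟨h1, h2⟩
      by_contra! h'
      exact h1 _ h' (Nat.sInf_mem (s := {n | t ≤ partialSum X n ω}) h2)
  rw [this]
  exact (MeasurableSet.biInter (to_countable _) fun m _ => (hm m).compl).inter
    (MeasurableSet.iUnion hm)

lemma measurable_residue (hX : ∀ i, Measurable (X i)) (t : ℝ) : Measurable (residue X t) := by
  have h : Measurable fun p : Ω × ℕ => partialSum X p.2 p.1 :=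
    measurable_from_prod_countable_left fun n => measurable_partialSum hX n
  exact (h.comp (measurable_id.prodMk (measurable_stoppingTime hX t))).sub_const t

end Pathwise

/-! ### The first-step decomposition -/

section Independence

variable {Ω : Type*} [MeasurableSpace Ω] {P : Measure Ω} {X : ℕ → Ω → ℝ}

lemma indepFun_zero_shift (hX : ∀ i, Measurable (X i)) (h : iIndepFun X P) :
    IndepFun (X 0) (fun ω i => X (i + 1) ω) P := by
  rw [IndepFun_iff_Indep]
  have h1 := indep_iSup_of_disjoint (S := {0}) (T := {i | 0 < i})
    (fun i => (hX i).comap_le) ((iIndepFun_iff_iIndep _ _ _).mp h) (by simp)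
  refine indep_of_indep_of_le_left (indep_of_indep_of_le_right h1 ?_) ?_
  · rw [MeasurableSpace.pi, MeasurableSpace.comap_iSup]
    refine iSup_le fun i => ?_
    rw [MeasurableSpace.comap_comp]
    exact le_iSup₂_of_le (i + 1) (Nat.succ_pos i) le_rfl
  · exact le_iSup₂_of_le 0 (mem_singleton 0) le_rfl

variable [IsProbabilityMeasure P] {F : Finset ℝ} {w : ℝ → ℝ} {a L : ℝ}

/-- The expectation of a bounded function of the residue solves the delay equation. -/
lemma integral_residue_eq_sol (hw : IsStepLaw F w a L) {g : ℝ → ℝ} (hg : Measurable g)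
    (hb : ∀ x, |g x| ≤ 1) (n : ℕ) : ∀ (X : ℕ → Ω → ℝ), (∀ i, Measurable (X i)) →
      (∀ i, ∀ᵐ ω ∂P, X i ω ∈ F) → (∀ i, ∀ x ∈ F, P.real (X i ⁻¹' {x}) = w x) → iIndepFun X P →
      ∀ t, t ≤ n * a → ∫ ω, g (residue X t ω) ∂P = sol F w a g t := by
  have base : ∀ (X : ℕ → Ω → ℝ) t, t ≤ 0 → ∫ ω, g (residue X t ω) ∂P = sol F w a g t := by
    intro X t ht
    simp [residue_of_nonpos ht, hw.sol_of_nonpos g ht]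
  induction n with
  | zero => intro X _ _ _ _ t ht; exact base X t (by simpa using ht)
  | succ n ih =>
    intro X hX hF hlaw hind t ht
    rcases le_or_gt t 0 with h0 | h0
    · exact base X t h0
    set Y : ℕ → Ω → ℝ := fun i => X (i + 1)
    have hYm : ∀ i, Measurable (Y i) := fun i => hX _
    have hYind : iIndepFun Y P := hind.precomp (g := fun i => i + 1) (add_left_injective 1)
    -- Splitting over the finitely many values of the first step makes the level t - x deterministic
    -- in each term.
    have hae : ∀ᵐ ω ∂P, g (residue X t ω) =
        ∑ x ∈ F, ({x} : Set ℝ).indicator (fun _ => (1 : ℝ)) (X 0 ω) * g (residue Y (t - x) ω) := by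
      filter_upwards [ae_all_iff.mpr hF] with ω hω
      rw [residue_eq_shift h0
        (exists_le_partialSum hw.min_pos (fun i => hw.min_le _ (hω i)) t)]
      rw [Finset.sum_eq_single_of_mem (X 0 ω) (hω 0)]
      · simp [Y]
      · intro x _ hx
        rw [indicator_of_notMem (by simpa using hx.symm), zero_mul]
    have hm1 : ∀ x : ℝ, Measurable (({x} : Set ℝ).indicator fun _ => (1 : ℝ)) := fun x =>
      measurable_const.indicator (measurableSet_singleton x)
    have hm2 : ∀ x, Measurable fun ω => g (residue Y (t - x) ω) := fun x =>
      hg.comp (measurable_residue hYm _)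
    rw [integral_congr_ae hae, integral_finsetSum]
    · rw [hw.sol_delayEq g t h0]
      refine Finset.sum_congr rfl fun x hx => ?_
      have hi : IndepFun (fun ω => ({x} : Set ℝ).indicator (fun _ => (1 : ℝ)) (X 0 ω))
          (fun ω => g (residue Y (t - x) ω)) P :=
        (indepFun_zero_shift hX hind).comp (hm1 x)
          -- On sequence space with coordinate maps, the residue becomes a measurable function of
          -- the shifted sequence, as independence requires.
          (hg.comp (measurable_residue (X := fun i (y : ℕ → ℝ) => y i)
            (fun i => measurable_pi_apply i) (t - x)))
      rw [hi.integral_fun_mul_eq_mul_integral ((hm1 x).comp (hX 0)).aestronglyMeasurable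
        (hm2 x).aestronglyMeasurable]
      rw [ih Y hYm (fun i => hF _) (fun i => hlaw _) hYind (t - x)
        (by push_cast at ht; linarith [hw.min_le x hx])]
      congr 1
      rw [← hlaw 0 x hx]
      have : (fun ω => ({x} : Set ℝ).indicator (fun _ => (1 : ℝ)) (X 0 ω)) =
          (X 0 ⁻¹' {x}).indicator fun _ => 1 := rfl
      rw [this, integral_indicator_const _ (hX 0 (measurableSet_singleton x)), smul_eq_mul, mul_one]
    · intro x _
      refine Integrable.of_bound
        (((hm1 x).comp (hX 0)).mul (hm2 x)).aestronglyMeasurable 1 (ae_of_all _ fun ω => ?_)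
      rw [norm_mul]
      refine mul_le_one₀ ?_ (norm_nonneg _) (hb _)
      by_cases h : X 0 ω ∈ ({x} : Set ℝ)
      · simp only [indicator_of_mem h, norm_one, le_refl]
      · simp only [indicator_of_notMem h, norm_zero, zero_le_one]

end Independence

/-! ### Bounds from the local C^1 norm -/

section LocalNorm

variable {g : ℝ → ℂ} {L : ℝ}

lemma le_localC1Norm (hg : ContDiff ℝ 1 g) {x : ℝ} (hx : x ∈ Ioo (-1) (L + 1)) :
    ‖g x‖ + ‖deriv g x‖ ≤ localC1Norm L g := by
  have hc : Continuous fun x => ‖g x‖ + ‖deriv g x‖ :=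
    hg.continuous.norm.add (hg.continuous_deriv le_rfl).norm
  refine le_csSup ?_ (mem_image_of_mem _ hx)
  exact (isCompact_Icc.image hc).bddAbove.mono (image_mono Ioo_subset_Icc_self)

lemma norm_sub_le_localC1Norm (hg : ContDiff ℝ 1 g) {x y : ℝ} (hx : x ∈ Ioo (-1) (L + 1))
    (hy : y ∈ Ioo (-1) (L + 1)) : ‖g x - g y‖ ≤ localC1Norm L g * |x - y| :=
  (convex_Ioo (-1) (L + 1)).norm_image_sub_le_of_norm_deriv_le
    (fun z _ => (hg.differentiable one_ne_zero) z)
    (fun z hz => by linarith [le_localC1Norm hg hz, norm_nonneg (g z)]) hy hx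

end LocalNorm

/-! ### Reduction to normalised data and conclusion -/

section Main

variable {lam : Measure ℝ} {Ω : Type*} [MeasurableSpace Ω] {P : Measure Ω} {X : ℕ → Ω → ℝ}

lemma ae_mem_support (hX : ∀ i, Measurable (X i)) (hlaw : ∀ i, P.map (X i) = lam) :
    ∀ᵐ ω ∂P, ∀ i, X i ω ∈ lam.support := by
  refine ae_all_iff.mpr fun i => ae_of_ae_map (hX i).aemeasurable (p := fun x => x ∈ lam.support) ?_
  rw [hlaw i]
  exact Measure.support_mem_ae

lemma expectation_eq_mean [IsProbabilityMeasure lam] (hfin : lam.support.Finite) :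
    expectation lam = mean hfin.toFinset fun x => lam.real {x} :=
  integral_eq_sum_support hfin _

variable [IsProbabilityMeasure P]

/-- The estimate for one real coordinate `u ∘ g`, with any bound `N` exceeding the norm. -/
lemma coordinate_bound (hfin : lam.support.Finite) {a : ℝ}
    (hw : IsStepLaw hfin.toFinset (fun x => lam.real {x}) a (suppBound lam)) {o : ℝ → ℝ}
    (ho : ∀ g : ℝ → ℝ, (∀ x, |g x| ≤ 1) → (∀ x y, |g x - g y| ≤ |x - y|) → ∀ t,
      |sol hfin.toFinset (fun x => lam.real {x}) a g t -
        tailIntegral hfin.toFinset (fun x => lam.real {x}) g /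
          mean hfin.toFinset fun x => lam.real {x}| ≤ o t)
    (hX : ∀ i, Measurable (X i)) (hlaw : ∀ i, P.map (X i) = lam) (hind : iIndepFun X P)
    {t : ℝ} (ht : 0 < t) {g : ℝ → ℂ} (hg : ContDiff ℝ 1 g) (u : ℂ →L[ℝ] ℝ)
    (hu : ∀ z, |u z| ≤ ‖z‖) {N : ℝ} (hN : 0 < N) (hgN : localC1Norm (suppBound lam) g ≤ N) :
    |(∫ ω, u (g (residue X t ω)) ∂P) -
      tailIntegral hfin.toFinset (fun x => lam.real {x}) (fun x => u (g x)) /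
        mean hfin.toFinset fun x => lam.real {x}| ≤ o t * N := by
  set L := suppBound lam
  have hL := hw.L_pos
  -- The norm controls g only near [0, L]. Clamping makes the bounds global and changes neither
  -- side, since residues almost surely, and the tail integrals always, see only [0, L].
  let c : ℝ → ℝ := fun x => projIcc 0 L hL.le x
  have hc : ∀ x, c x ∈ Ioo (-1) (L + 1) := fun x => by
    have := (projIcc 0 L hL.le x).2
    exact ⟨by linarith [this.1], by linarith [this.2]⟩
  have hcid : ∀ x ∈ Icc 0 L, c x = x := fun x hx => by
    simp only [c, projIcc_of_mem hL.le hx]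
  let f : ℝ → ℝ := fun x => N⁻¹ * u (g (c x))
  have hNi : 0 < N⁻¹ := inv_pos.mpr hN
  have hNN : N⁻¹ * N = 1 := inv_mul_cancel₀ hN.ne'
  have hf1 : ∀ x, |f x| ≤ 1 := by
    intro x
    simp only [f]
    rw [abs_mul, abs_of_pos hNi, ← hNN]
    refine mul_le_mul_of_nonneg_left ((hu _).trans ?_) hNi.le
    linarith [le_localC1Norm hg (hc x), norm_nonneg (deriv g (c x))]
  have hf2 : ∀ x y, |f x - f y| ≤ |x - y| := by
    intro x y
    simp only [f]
    rw [← mul_sub, abs_mul, abs_of_pos hNi, ← map_sub]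
    have h1 : |c x - c y| ≤ |x - y| := abs_projIcc_sub_projIcc hL.le
    have h2 : |u (g (c x) - g (c y))| ≤ N * |x - y| :=
      (hu _).trans ((norm_sub_le_localC1Norm hg (hc x) (hc y)).trans
        (mul_le_mul hgN h1 (abs_nonneg _) hN.le))
    calc N⁻¹ * |u (g (c x) - g (c y))| ≤ N⁻¹ * (N * |x - y|) :=
          mul_le_mul_of_nonneg_left h2 hNi.le
      _ = |x - y| := by rw [← mul_assoc, hNN, one_mul]
  have hfm : Measurable f := by
    have : Continuous f := continuous_const.mul (u.continuous.comp
      (hg.continuous.comp (continuous_subtype_val.comp continuous_projIcc)))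
    exact this.measurable
  obtain ⟨n, hn⟩ := hw.exists_nat_mul_ge t
  have hmem := ae_mem_support hX hlaw
  have e1 := integral_residue_eq_sol (P := P) hw hfm hf1 n X hX
    (fun i => by filter_upwards [hmem] with ω hω; exact hfin.mem_toFinset.mpr (hω i))
    (fun i x _ => by
      rw [← hlaw i, measureReal_def, measureReal_def,
        Measure.map_apply (hX i) (measurableSet_singleton x)]) hind t hn
  have e2 : ∫ ω, f (residue X t ω) ∂P = N⁻¹ * ∫ ω, u (g (residue X t ω)) ∂P := by
    rw [← integral_const_mul]
    refine integral_congr_ae ?_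
    filter_upwards [hmem] with ω hω
    have hω' : ∀ i, X i ω ∈ hfin.toFinset := fun i => hfin.mem_toFinset.mpr (hω i)
    simp only [f]
    rw [hcid _ (residue_mem_Icc ht (fun i => hw.le_max _ (hω' i))
      (exists_le_partialSum hw.min_pos (fun i => hw.min_le _ (hω' i)) t))]
  have e3 : tailIntegral hfin.toFinset (fun x => lam.real {x}) f =
      N⁻¹ * tailIntegral hfin.toFinset (fun x => lam.real {x}) (fun x => u (g x)) := by
    rw [tailIntegral, tailIntegral, Finset.mul_sum]
    refine Finset.sum_congr rfl fun x hx => ?_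
    rw [mul_left_comm, ← intervalIntegral.integral_const_mul N⁻¹]
    refine congrArg (lam.real {x} * ·) ?_
    refine intervalIntegral.integral_congr fun y hy => ?_
    rw [uIcc_of_le (hw.x_pos hx).le] at hy
    simp only [f]
    rw [hcid y ⟨hy.1, hy.2.trans (hw.le_max x hx)⟩]
  have key := ho f hf1 hf2 t
  rw [← e1, e2, e3, mul_div_assoc, ← mul_sub, abs_mul, abs_of_pos hNi] at key
  rwa [inv_mul_le_iff₀' hN] at key

end Main
end RenewalStopping

open MeasureTheory ProbabilityTheory Filter Topology RenewalStopping in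
theorem proposition2p1 (lam : Measure ℝ) [IsProbabilityMeasure lam]
    (hpos : ∀ᵐ x ∂lam, 0 < x) (hfin : lam.support.Finite) (hlat : IsNonLattice lam) :
    (IsPiecewiseConstant (tail lam) ∧ ∀ x : ℝ, suppBound lam ≤ x → tail lam x = 0) ∧
    ∃ o : ℝ → ℝ, Tendsto o atTop (𝓝 0) ∧
      ∀ (Ω : Type*) [MeasurableSpace Ω] (P : Measure Ω) [IsProbabilityMeasure P]
        (X : ℕ → Ω → ℝ), (∀ i, Measurable (X i)) → (∀ i, P.map (X i) = lam) →
        iIndepFun X P →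
        ∀ t : ℝ, suppBound lam + 1 < t →
          (∀ᵐ ω ∂P, ∃ n : ℕ, t ≤ partialSum X n ω) ∧
          ∀ g : ℝ → ℂ, ContDiff ℝ 1 g →
            Integrable (fun ω => g (residue X t ω)) P ∧
            IntegrableOn (fun x : ℝ => g x * (tail lam x : ℂ)) (Set.Ioi 0) ∧
            ‖(∫ ω, g (residue X t ω) ∂P) -
                (1 / (expectation lam : ℂ)) * ∫ x in Set.Ioi (0 : ℝ), g x * (tail lam x : ℂ)‖
              ≤ o t * localC1Norm (suppBound lam) g := by
  refine ⟨⟨tail_isPiecewiseConstant hfin, fun x hx => tail_eq_zero hfin hx⟩, ?_⟩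
  obtain ⟨a, hw⟩ := exists_isStepLaw hpos hfin
  obtain ⟨o, ho0, ho⟩ := hw.exists_rate (by rw [hfin.coe_toFinset]; exact hlat)
  -- The factor 2 accounts for the real and imaginary parts.
  refine ⟨fun t => 2 * o t, by simpa using ho0.const_mul 2, ?_⟩
  intro Ω _ P _ X hX hlaw hind t ht
  have hL := hw.L_pos
  have ht0 : 0 < t := by linarith
  have hmem : ∀ᵐ ω ∂P, ∀ i, X i ω ∈ hfin.toFinset := by
    filter_upwards [ae_mem_support hX hlaw] with ω hω i
    exact hfin.mem_toFinset.mpr (hω i)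
  have hex : ∀ᵐ ω ∂P, ∃ n : ℕ, t ≤ partialSum X n ω := by
    filter_upwards [hmem] with ω hω
    exact exists_le_partialSum hw.min_pos (fun i => hw.min_le _ (hω i)) t
  refine ⟨hex, fun g hg => ?_⟩
  have hint : Integrable (fun ω => g (residue X t ω)) P := by
    refine Integrable.of_bound
      (hg.continuous.measurable.comp (measurable_residue hX t)).aestronglyMeasurable
      (localC1Norm (suppBound lam) g) ?_
    filter_upwards [hmem, hex] with ω hω h
    have hr := residue_mem_Icc ht0 (fun i => hw.le_max _ (hω i)) h
    have := le_localC1Norm (L := suppBound lam) hg (x := residue X t ω)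
      ⟨by linarith [hr.1], by linarith [hr.2]⟩
    linarith [norm_nonneg (deriv g (residue X t ω))]
  obtain ⟨hti, hte⟩ := integral_mul_tail hpos hfin hg.continuous
  refine ⟨hint, hti, ?_⟩
  set N := localC1Norm (suppBound lam) g
  have hN0 : 0 ≤ N :=
    (add_nonneg (norm_nonneg _) (norm_nonneg _)).trans
      (le_localC1Norm hg (x := 0) ⟨by norm_num, by linarith⟩)
  set z := (∫ ω, g (residue X t ω) ∂P) -
    (1 / (expectation lam : ℂ)) * ∫ x in Set.Ioi (0 : ℝ), g x * (tail lam x : ℂ)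
  have hz : ∀ u : ℂ →L[ℝ] ℝ, u z = (∫ ω, u (g (residue X t ω)) ∂P) -
      tailIntegral hfin.toFinset (fun x => lam.real {x}) (fun x => u (g x)) /
        mean hfin.toFinset fun x => lam.real {x} := by
    intro u
    have h1 : (1 / (expectation lam : ℂ)) * ∫ x in Set.Ioi (0 : ℝ), g x * (tail lam x : ℂ) =
        (expectation lam)⁻¹ • ∫ x in Set.Ioi (0 : ℝ), g x * (tail lam x : ℂ) := by
      rw [Complex.real_smul, Complex.ofReal_inv, one_div]
    simp only [z]
    rw [h1, map_sub, map_smul, ← ContinuousLinearMap.integral_comp_comm u hint, hte, map_sum, expectation_eq_mean hfin,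
      smul_eq_mul, inv_mul_eq_div, tailIntegral]
    congr 2
    refine Finset.sum_congr rfl fun x _ => ?_
    rw [map_smul, smul_eq_mul,
      ← ContinuousLinearMap.intervalIntegral_comp_comm u (hg.continuous.intervalIntegrable 0 x)]
  have hbound : ∀ u : ℂ →L[ℝ] ℝ, (∀ z, |u z| ≤ ‖z‖) → |u z| ≤ o t * N := by
    -- N may vanish, so the rescaling uses M > N, and M then decreases to N.
    intro u hu
    have hlim : Tendsto (fun M => o t * M) (𝓝[>] N) (𝓝 (o t * N)) :=
      ((continuous_const.mul continuous_id).tendsto N).mono_left nhdsWithin_le_nhds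
    refine ge_of_tendsto hlim ?_
    filter_upwards [self_mem_nhdsWithin] with M hM
    rw [hz u]
    exact coordinate_bound hfin hw ho hX hlaw hind ht0 hg u hu (hN0.trans_lt hM) (le_of_lt hM)
  have hre := hbound Complex.reCLM Complex.abs_re_le_norm
  have him := hbound Complex.imCLM Complex.abs_im_le_norm
  refine (Complex.norm_le_abs_re_add_abs_im z).trans ?_
  simp only [Complex.reCLM_apply, Complex.imCLM_apply] at hre him
  linarith
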